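/- Let $(R,\mathfrak m,K)$ be a complete Noetherian local ring of Krull dimension $d$ that is Gorenstein (i.e. of finite injective dimension over itself). Let $E$ be an injective hull of $K$, put $H=H^d_{\mathfrak m}(R)$, and let $\omega$ be a canonical module of $R$, i.e. a finitely generated $R$-module with a fixed isomorphism $H\cong \operatorname{Hom}_R(\omega,E)$. Let $\mathrm{cl}$ be a closure operation on $R$-modules: to each pair of $R$-modules $N\subseteq M$ it assigns a submodule $N_M^{\mathrm{cl}}\subseteq M$ such that $N\subseteq N_M^{\mathrm{cl}}=(N_M^{\mathrm{cl}})_M^{\mathrm{cl}}$, and $N_M^{\mathrm{cl}}\subseteq (N')_M^{\mathrm{cl}}$ whenever $N\subseteq N'\subseteq M$. Assume that $\mathrm{cl}$ is - functorial: $f(L_M^{\mathrm{cl}})\subseteq f(L)_N^{\mathrm{cl}}$ for every $R$-linear map $f:M\to N$ and every submodule $L\subseteq M$; - residual: $N_M^{\mathrm{cl}}=\pi^{-1}\big((N/L)_{M/L}^{\mathrm{cl}}\big)$ for all $R$-modules $L\subseteq N\subseteq M$, where $\pi:M\to M/L$ is the quotient map; and satisfies the injective finiteness condition: $0_H^{\mathrm{cl}}=\bigcup_G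 0_G^{\mathrm{cl}}$, the union being over the finitely generated submodules $G$ of $H$. Then the following are equivalent: 1. $R$ is weakly $\mathrm{cl}$-regular, i.e. $N_M^{\mathrm{cl}}=N$ for every finitely generated $R$-module $M$ and every submodule $N\subseteq M$. 2. $R$ is $\mathrm{cl}$-rational, i.e. $\tau_{\mathrm{cl}}(\omega)=\omega$, where $\tau_{\mathrm{cl}}(\omega):=\operatorname{Ann}_\omega(0_H^{\mathrm{cl}})$ is the set of $w\in\omega$ on which every element of $0_H^{\mathrm{cl}}$, viewed in $\operatorname{Hom}_R(\omega,E)$, vanishes. -/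

import Mathlib

universe u

/-- A closure operation on `R`-modules: to every `R`-module `M` and every submodule `N` of `M`
it attaches a submodule `N_M^cl = cl.closure M N` of `M`. -/
structure ModuleClosure (R : Type u) [CommRing R] where
  closure : ∀ (M : Type u) [AddCommGroup M] [Module R M], Submodule R M → Submodule R M
  le_closure : ∀ (M : Type u) [AddCommGroup M] [Module R M] (N : Submodule R M),
    N ≤ closure M N
  closure_closure : ∀ (M : Type u) [AddCommGroup M] [Module R M] (N : Submodule R M),
    closure M (closure M N) = closure M N
  closure_mono : ∀ (M : Type u) [AddCommGroup M] [Module R M] (N N' : Submodule R M),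
    N ≤ N' → closure M N ≤ closure M N'

namespace ModuleClosure

variable {R : Type u} [CommRing R]

/-- `f(L_M^cl) ⊆ f(L)_N^cl` for all linear maps `f : M → N` and all submodules `L` of `M`. -/
def IsFunctorial (cl : ModuleClosure R) : Prop :=
  ∀ (M N : Type u) [AddCommGroup M] [Module R M] [AddCommGroup N] [Module R N]
    (f : M →ₗ[R] N) (L : Submodule R M),
    (cl.closure M L).map f ≤ cl.closure N (L.map f)

/-- `N_M^cl = π⁻¹((N/L)_{M/L}^cl)` for all `L ⊆ N ⊆ M`, where `π : M → M/L` is the quotient map. -/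
def IsResidual (cl : ModuleClosure R) : Prop :=
  ∀ (M : Type u) [AddCommGroup M] [Module R M] (L N : Submodule R M), L ≤ N →
    cl.closure M N = (cl.closure (M ⧸ L) (N.map L.mkQ)).comap L.mkQ

/-- The finitistic version of `cl`: the union (a subset of `M`) of all `L_N^cl`, where
`L ⊆ N ⊆ M` and `N/L` is finitely generated. -/
def finitisticClosure (cl : ModuleClosure R) (M : Type u) [AddCommGroup M] [Module R M]
    (L : Submodule R M) : Set M :=
  {x | ∃ N : Submodule R M, L ≤ N ∧ Module.Finite R (N ⧸ L.submoduleOf N) ∧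
    x ∈ (cl.closure N (L.submoduleOf N)).map N.subtype}

/-- Every submodule of every finitely generated `R`-module is `cl`-closed. -/
def IsWeaklyRegular (cl : ModuleClosure R) : Prop :=
  ∀ (M : Type u) [AddCommGroup M] [Module R M], Module.Finite R M →
    ∀ N : Submodule R M, cl.closure M N = N

end ModuleClosure

/-- `E` is an injective hull of the `R`-module `K`: it is injective, and an essential extension
of a copy of `K`. -/
def IsInjectiveHull (R : Type u) [CommRing R] (K : Type u) [AddCommGroup K] [Module R K]
    (E : Type u) [AddCommGroup E] [Module R E] : Prop :=
  Module.Injective R E ∧ ∃ i : K →ₗ[R] E, Function.Injective i ∧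
    ∀ S : Submodule R E, S ⊓ LinearMap.range i = ⊥ → S = ⊥

/-- A Noetherian local ring is Gorenstein if it has finite injective dimension as a module over
itself. -/
def IsGorensteinLocalRing (R : Type u) [CommRing R] [IsLocalRing R] [IsNoetherianRing R] : Prop :=
  ∃ n : ℕ, CategoryTheory.HasInjectiveDimensionLE (ModuleCat.of.{u} R R) n

/-- The Krull dimension of a Noetherian local ring, as a natural number. -/
noncomputable def localKrullDim (R : Type u) [CommRing R] : ℕ :=
  ((ringKrullDim R).unbotD 0).toNat

theorem coe_localKrullDim (R : Type u) [CommRing R] [IsLocalRing R] [IsNoetherianRing R] :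
    ((localKrullDim R : ℕ∞) : WithBot ℕ∞) = ringKrullDim R := by
  have h1 : ringKrullDim R ≠ ⊥ := ringKrullDim_ne_bot
  have h2 : ringKrullDim R ≠ ⊤ := ringKrullDim_ne_top
  unfold localKrullDim
  obtain ⟨a, ha⟩ := WithBot.ne_bot_iff_exists.mp h1
  rw [← ha] at h2 ⊢
  have h3 : a ≠ ⊤ := fun h => h2 (by rw [h]; rfl)
  rw [WithBot.unbotD_coe, ENat.natCast_toNat h3]

/-- The top local cohomology module `H_m^d(R)` of a local ring `(R, m)` of Krull dimension `d`. -/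
noncomputable abbrev topLocalCohomology (R : Type u) [CommRing R] [IsLocalRing R] :
    ModuleCat.{u} R :=
  (localCohomology (IsLocalRing.maximalIdeal R) (localKrullDim R)).obj (ModuleCat.of R R)

/-- `ω` is a canonical module of the local ring `(R, m)`, where `E` is an injective hull of the
residue field: it is finitely generated, and its Matlis dual `Hom_R(ω, E)` is identified with
`H_m^d(R)`. -/
structure CanonicalModuleStructure (R : Type u) [CommRing R] [IsLocalRing R]
    (E : Type u) [AddCommGroup E] [Module R E] (ω : Type u) [AddCommGroup ω] [Module R ω] where
  finite : Module.Finite R ω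
  dualEquiv : topLocalCohomology R ≃ₗ[R] (ω →ₗ[R] E)

/-- The annihilator in `M` of a submodule `N` of `M^∨ = Hom_R(M, E)`: the elements of `M` which,
viewed in `M^∨^∨` by evaluation, vanish on `N`. -/
def matlisAnnihilator {R : Type u} [CommRing R] {E : Type u} [AddCommGroup E] [Module R E]
    {M : Type u} [AddCommGroup M] [Module R M] (N : Submodule R (M →ₗ[R] E)) :
    Submodule R M where
  carrier := {w | ∀ f ∈ N, f w = 0}
  add_mem' ha hb f hf := by rw [map_add, ha f hf, hb f hf, add_zero]
  zero_mem' f _ := map_zero f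
  smul_mem' r w hw f hf := by rw [map_smul, hw f hf, smul_zero]

namespace ModuleClosure

variable {R : Type u} [CommRing R] [IsLocalRing R]

/-- The injective finiteness condition: the closure of `0` in `H_m^d(R)` under `cl` agrees with
the closure of `0` in `H_m^d(R)` under the finitistic version of `cl`. -/
def InjectiveFiniteness (cl : ModuleClosure R) : Prop :=
  (cl.closure (topLocalCohomology R) ⊥ : Set (topLocalCohomology R)) =
    cl.finitisticClosure (topLocalCohomology R) ⊥

variable {E : Type u} [AddCommGroup E] [Module R E] {ω : Type u} [AddCommGroup ω] [Module R ω]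

/-- The test submodule `τ_cl(ω) = Ann_ω(0_{H_m^d(R)}^cl)` of the canonical module. -/
noncomputable def testSubmodule (cl : ModuleClosure R) (c : CanonicalModuleStructure R E ω) :
    Submodule R ω :=
  matlisAnnihilator ((cl.closure (topLocalCohomology R) ⊥).map c.dualEquiv.toLinearMap)

/-- `R` is `cl`-rational if `τ_cl(ω) = ω`. -/
def IsRational (cl : ModuleClosure R) (c : CanonicalModuleStructure R E ω) : Prop :=
  cl.testSubmodule c = ⊤

end ModuleClosure

/-! Both conditions are equivalent to 0_H^cl = 0. Since H is identified with Hom(ω, E), τ_cl(ω) = ω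
says exactly this, and weak regularity gives it by injective finiteness. Conversely, residuality
reduces the claim to closedness of 0 in a finitely generated module, and functoriality sends every
element of 0_M^cl into 0_H^cl = 0. It remains that H cogenerates the finitely generated modules.

This is `IsGorensteinLocalRing.exists_hom_topLocalCohomology_ne_zero`, proved without identifying H
with E. By Krull's intersection theorem M may be taken to be killed by m^k. A class t in Ext^d(M, R)
defines a map M → H = colim Ext^d(R/m^l, R): send y to the pullback of t along 1 ↦ y. If t restricts
to a nonzero class on Rx, then x has nonzero image (`exists_hom_localCohomology`).

The inputs are Ext^(d+1)(-, R) = 0 on finitely generated modules, Ext^j(-, R) = 0 for j < d on those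
killed by a power of m, and Ext^d(Rx, R) ≠ 0. They come from a regular sequence of maximal length:
finite injective dimension kills Ext above that length (`subsingleton_ext_of_length_lt`), which
forces the length to be d (`length_eq_localKrullDim`). -/

open CategoryTheory Limits

/-! ### Cocycle classes and functoriality of Ext through projective resolutions -/

lemma CategoryTheory.inv_comp_inv_naturality {D : Type*} [Category D] {T T' B B' A A' : D}
    (i : T ≅ B) (i' : T' ≅ B') (h : B ≅ A) (h' : B' ≅ A') {t : T ⟶ T'} {m : B ⟶ B'} {a : A ⟶ A'}
    (hi : i.inv ≫ t = m ≫ i'.inv) (hh : m ≫ h'.hom = h.hom ≫ a) :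
    (h.inv ≫ i.inv) ≫ t = a ≫ h'.inv ≫ i'.inv := by
  rw [Category.assoc, hi, Iso.inv_comp_eq, ← reassoc_of% hh, Iso.hom_inv_id_assoc]

namespace CochainComplex
noncomputable section
variable {R : Type u} [CommRing R] (K L : CochainComplex (ModuleCat.{u} R) ℕ)

/-- The linear map sending a cocycle to its class in the cohomology module. -/
def cocycleClass (n : ℕ) : LinearMap.ker (K.d n (n + 1)).hom →ₗ[R] K.homology n :=
  (K.liftCycles (ModuleCat.ofHom (LinearMap.ker (K.d n (n + 1)).hom).subtype)
    (n + 1) (by simp) (by ext x; exact x.2) ≫ K.homologyπ n).hom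

variable {K L}

lemma cocycleClass_surjective (n : ℕ) : Function.Surjective (K.cocycleClass n) := by
  have h1 : Function.Surjective (K.homologyπ n).hom :=
    (ModuleCat.epi_iff_surjective _).1 inferInstance
  have h3 : Function.Injective (K.iCycles n).hom :=
    (ModuleCat.mono_iff_injective _).1 inferInstance
  intro y
  obtain ⟨z, rfl⟩ := h1 y
  refine ⟨⟨(K.iCycles n).hom z, ?_⟩, ?_⟩
  · rw [LinearMap.mem_ker, ← LinearMap.comp_apply, ← ModuleCat.hom_comp,
      HomologicalComplex.iCycles_d]
    rfl
  · simp only [cocycleClass, ModuleCat.hom_comp, LinearMap.comp_apply]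
    congr 1
    apply h3
    rw [← LinearMap.comp_apply, ← ModuleCat.hom_comp, HomologicalComplex.liftCycles_i]
    rfl

lemma cocycleClass_eq_zero_iff (n : ℕ) (g : LinearMap.ker (K.d n (n + 1)).hom) :
    K.cocycleClass n g = 0 ↔ ∃ p, (K.d ((ComplexShape.up ℕ).prev n) n).hom p = g.1 := by
  have h3 : Function.Injective (K.iCycles n).hom :=
    (ModuleCat.mono_iff_injective _).1 inferInstance
  have h4 : ∀ c, (K.homologyπ n).hom c = 0 ↔ ∃ p, (K.toCycles _ n).hom p = c := fun c ↦ by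
    -- Homology is the cokernel of `toCycles`, so a cycle has zero class exactly when it is a
    -- boundary.
    have := ShortComplex.exact_of_g_is_cokernel
      (ShortComplex.mk _ _ (K.toCycles_comp_homologyπ _ n)) (K.homologyIsCokernel _ n rfl)
    rw [ShortComplex.moduleCat_exact_iff_range_eq_ker] at this
    exact (SetLike.ext_iff.1 this c).symm
  simp only [cocycleClass, ModuleCat.hom_comp, LinearMap.comp_apply]
  rw [h4]
  refine exists_congr fun p ↦ ?_
  rw [← h3.eq_iff, ← LinearMap.comp_apply, ← ModuleCat.hom_comp, HomologicalComplex.toCycles_i,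
    ← LinearMap.comp_apply (K.iCycles n).hom, ← ModuleCat.hom_comp,
    HomologicalComplex.liftCycles_i]
  rfl

lemma homologyMap_cocycleClass (φ : K ⟶ L) (n : ℕ) (g : LinearMap.ker (K.d n (n + 1)).hom)
    (g' : LinearMap.ker (L.d n (n + 1)).hom) (hg : g'.1 = (φ.f n).hom g.1) :
    (HomologicalComplex.homologyMap φ n).hom (K.cocycleClass n g) = L.cocycleClass n g' := by
  simp only [cocycleClass, ModuleCat.hom_comp, LinearMap.comp_apply]
  rw [← LinearMap.comp_apply, ← ModuleCat.hom_comp,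
    HomologicalComplex.homologyπ_naturality, ModuleCat.hom_comp, LinearMap.comp_apply]
  congr 1
  have h3 : Function.Injective (L.iCycles n).hom :=
    (ModuleCat.mono_iff_injective _).1 inferInstance
  apply h3
  rw [← LinearMap.comp_apply, ← ModuleCat.hom_comp, HomologicalComplex.cyclesMap_i,
    ModuleCat.hom_comp, LinearMap.comp_apply, ← LinearMap.comp_apply (K.iCycles n).hom,
    ← ModuleCat.hom_comp, HomologicalComplex.liftCycles_i, ← LinearMap.comp_apply (L.iCycles n).hom,
    ← ModuleCat.hom_comp, HomologicalComplex.liftCycles_i]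
  exact hg.symm

end
end CochainComplex

namespace CategoryTheory.ProjectiveResolution
noncomputable section
variable {R : Type u} [CommRing R] {X X' : ModuleCat.{u} R}

/-- The cochain map `Hom(P', Y) ⟶ Hom(P, Y)` given by precomposition with a chain map `P ⟶ P'`. -/
def linearYonedaMap {K L : ChainComplex (ModuleCat.{u} R) ℕ} (φ : K ⟶ L) (Y : ModuleCat.{u} R) :
    L.linearYonedaObj R Y ⟶ K.linearYonedaObj R Y :=
  (HomologicalComplex.unopFunctor _ _).map
    ((((linearYoneda R (ModuleCat.{u} R)).obj Y).rightOp.mapHomologicalComplex _).map φ).op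

lemma isoExt_hom_naturality (P : ProjectiveResolution X) (P' : ProjectiveResolution X')
    {f : X ⟶ X'} (φ : Hom P P' f) (n : ℕ) (Y : ModuleCat.{u} R) :
    ((Ext R (ModuleCat.{u} R) n).map f.op).app Y ≫ (P.isoExt n Y).hom =
      (P'.isoExt n Y).hom ≫ HomologicalComplex.homologyMap (linearYonedaMap φ.hom Y) n := by
  apply Quiver.Hom.op_inj
  exact inv_comp_inv_naturality _ _
    ((P.complex.linearYonedaObj R Y).homologyOp n) ((P'.complex.linearYonedaObj R Y).homologyOp n)
    (ProjectiveResolution.isoLeftDerivedObj_inv_naturality f P P' φ.hom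
      φ.hom_f_zero_comp_π_f_zero ((linearYoneda R (ModuleCat.{u} R)).obj Y).rightOp n)
    (HomologicalComplex.homologyOp_hom_naturality (linearYonedaMap φ.hom Y) n)

/-- The submodule of cocycles `g : P_n ⟶ Y`. -/
def cocycles (P : ProjectiveResolution X) (n : ℕ) (Y : ModuleCat.{u} R) :
    Submodule R (P.complex.X n ⟶ Y) where
  carrier := {g | P.complex.d (n + 1) n ≫ g = 0}
  add_mem' {a b} ha hb := by
    simp only [Set.mem_ofPred_eq] at ha hb ⊢
    rw [Preadditive.comp_add, ha, hb, add_zero]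
  zero_mem' := comp_zero
  smul_mem' r a ha := by
    simp only [Set.mem_ofPred_eq] at ha ⊢
    rw [Linear.comp_smul, ha, smul_zero]

lemma mem_cocycles {P : ProjectiveResolution X} {n : ℕ} {Y : ModuleCat.{u} R}
    {g : P.complex.X n ⟶ Y} : g ∈ P.cocycles n Y ↔ P.complex.d (n + 1) n ≫ g = 0 :=
  Iff.rfl

/-- The linear map sending a cocycle `g : P_n ⟶ Y` to its class in `Ext^n(X, Y)`. -/
def cocycleToExt (P : ProjectiveResolution X) (n : ℕ) (Y : ModuleCat.{u} R) :
    P.cocycles n Y →ₗ[R] ((Ext R (ModuleCat.{u} R) n).obj (Opposite.op X)).obj Y :=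
  (P.isoExt n Y).inv.hom ∘ₗ (P.complex.linearYonedaObj R Y).cocycleClass n

lemma cocycleToExt_surjective (P : ProjectiveResolution X) (n : ℕ) (Y : ModuleCat.{u} R) :
    Function.Surjective (P.cocycleToExt n Y) :=
  ((ModuleCat.epi_iff_surjective (P.isoExt (R := R) n Y).inv).1 inferInstance).comp
    (CochainComplex.cocycleClass_surjective n)

lemma cocycleToExt_eq_zero_iff (P : ProjectiveResolution X) (n : ℕ) (Y : ModuleCat.{u} R)
    (g : P.cocycles n Y) :
    P.cocycleToExt n Y g = 0 ↔
      ∃ p, P.complex.d n ((ComplexShape.up ℕ).prev n) ≫ p = g.1 :=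
  (map_eq_zero_iff _ ((ModuleCat.mono_iff_injective (P.isoExt (R := R) n Y).inv).1
    inferInstance)).trans (CochainComplex.cocycleClass_eq_zero_iff n _)

lemma Hom.comp_mem_cocycles {P : ProjectiveResolution X} {P' : ProjectiveResolution X'}
    {f : X ⟶ X'} (φ : Hom P P' f) {n : ℕ} {Y : ModuleCat.{u} R} (g : P'.cocycles n Y) :
    φ.hom.f n ≫ g.1 ∈ P.cocycles n Y := by
  have h : P'.complex.d (n + 1) n ≫ g.1 = 0 := g.2
  change P.complex.d (n + 1) n ≫ φ.hom.f n ≫ g.1 = 0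
  rw [← φ.hom.comm_assoc, h, comp_zero]

lemma map_cocycleToExt {P : ProjectiveResolution X} {P' : ProjectiveResolution X'}
    {f : X ⟶ X'} (φ : Hom P P' f) (n : ℕ) (Y : ModuleCat.{u} R) (g : P'.cocycles n Y) :
    (((Ext R (ModuleCat.{u} R) n).map f.op).app Y).hom (P'.cocycleToExt n Y g) =
      P.cocycleToExt n Y ⟨φ.hom.f n ≫ g.1, φ.comp_mem_cocycles g⟩ := by
  have h := congrArg (fun u ↦ u.hom (P'.cocycleToExt n Y g)) (isoExt_hom_naturality P P' φ n Y)
  have h1 : Function.Injective (P.isoExt (R := R) n Y).hom.hom :=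
    (ModuleCat.mono_iff_injective _).1 inferInstance
  apply h1
  refine h.trans ?_
  have e1 : ∀ y, (P'.isoExt (R := R) n Y).hom.hom ((P'.isoExt (R := R) n Y).inv.hom y) = y :=
    fun y ↦ Iso.inv_hom_id_apply _ y
  have e2 : ∀ y, (P.isoExt (R := R) n Y).hom.hom ((P.isoExt (R := R) n Y).inv.hom y) = y :=
    fun y ↦ Iso.inv_hom_id_apply _ y
  exact (congrArg (HomologicalComplex.homologyMap (linearYonedaMap φ.hom Y) n).hom
    (e1 _)).trans ((CochainComplex.homologyMap_cocycleClass _ _ _ _ rfl).trans (e2 _).symm)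

/-- The lift of a morphism to a morphism of projective resolutions. -/
def liftHom (f : X ⟶ X') (P : ProjectiveResolution X) (P' : ProjectiveResolution X') :
    Hom P P' f where
  hom := lift f P P'
  hom_f_zero_comp_π_f_zero := lift_commutes_zero f P P'

end
end CategoryTheory.ProjectiveResolution

/-! ### Linearity of Ext in the first variable; comparison of the two Ext constructions -/

namespace CategoryTheory
variable {R : Type u} [CommRing R] {X X' : ModuleCat.{u} R}

/-- If φ and ψ lift f and g to projective resolutions, then r • φ + ψ lifts r • f + g, and any lift
computes the induced map. -/
lemma ext_map_smul_add (n : ℕ) (Y : ModuleCat.{u} R) (r : R) (f g : X ⟶ X')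
    (x : ((Ext R (ModuleCat.{u} R) n).obj (Opposite.op X')).obj Y) :
    (((Ext R (ModuleCat.{u} R) n).map (r • f + g).op).app Y).hom x =
      r • (((Ext R (ModuleCat.{u} R) n).map f.op).app Y).hom x +
        (((Ext R (ModuleCat.{u} R) n).map g.op).app Y).hom x := by
  let P := projectiveResolution X
  let P' := projectiveResolution X'
  obtain ⟨c, rfl⟩ := P'.cocycleToExt_surjective n Y x
  let φ := ProjectiveResolution.liftHom f P P'
  let ψ := ProjectiveResolution.liftHom g P P'
  let χ : ProjectiveResolution.Hom P P' (r • f + g) :=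
    { hom := r • φ.hom + ψ.hom
      hom_f_zero_comp_π_f_zero := by
        have h1 := φ.hom_f_zero_comp_π_f_zero
        have h2 := ψ.hom_f_zero_comp_π_f_zero
        simp only [ChainComplex.single₀_map_f_zero] at h1 h2 ⊢
        simp only [HomologicalComplex.add_f_apply, HomologicalComplex.smul_f_apply,
          Preadditive.add_comp, Linear.smul_comp]
        rw [h1, h2]
        exact ((Preadditive.comp_add _ _ _ (P.π.f 0) (r • f) g).trans
          (congrArg (· + P.π.f 0 ≫ g) (Linear.comp_smul _ _ _ (P.π.f 0) r f))).symm }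
  rw [ProjectiveResolution.map_cocycleToExt φ, ProjectiveResolution.map_cocycleToExt ψ,
    ProjectiveResolution.map_cocycleToExt χ, ← map_smul, ← map_add]
  congr 1
  apply Subtype.ext
  change (r • φ.hom + ψ.hom).f n ≫ c.1 = r • (φ.hom.f n ≫ c.1) + ψ.hom.f n ≫ c.1
  simp

open Abelian in
lemma ProjectiveResolution.extMk_eq_zero_iff_of_prev (P : ProjectiveResolution X) (n : ℕ)
    (Y : ModuleCat.{u} R) (g : P.complex.X n ⟶ Y) (hg : P.complex.d (n + 1) n ≫ g = 0) :
    P.extMk g (n + 1) rfl hg = 0 ↔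
      ∃ p, P.complex.d n ((ComplexShape.up ℕ).prev n) ≫ p = g := by
  cases n with
  | succ n =>
    rw [CochainComplex.prev_nat_succ]
    exact P.extMk_eq_zero_iff g _ rfl hg n rfl
  | zero =>
    rw [← P.extEquivCohomologyClass.apply_eq_iff_eq, P.extEquivCohomologyClass_extMk,
      P.extEquivCohomologyClass_zero, CochainComplex.HomComplex.CohomologyClass.mk_eq_zero_iff]
    rw [CochainComplex.HomComplex.Cocycle.toSingleMk_mem_coboundaries_iff _ _ _ _ _ 1 (by simp)]
    -- Here `prev 0 = 0` is a default value and d 0 0 = 0; the cochain complex vanishes in degree 1.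
    -- On both sides only the zero cocycle is a coboundary.
    have h1 : P.complex.d 0 ((ComplexShape.up ℕ).prev 0) = 0 :=
      P.complex.shape _ _ (by simp)
    have h2 : P.cochainComplex.d (-((0 : ℕ) : ℤ)) 1 = 0 :=
      (CochainComplex.isZero_of_isStrictlyLE P.cochainComplex 0 1).eq_of_tgt _ _
    rw [h1, h2]
    simp only [zero_comp]
    constructor
    · rintro ⟨_, h⟩
      refine ⟨0, ?_⟩
      rw [← cancel_epi (P.cochainComplexXIso (-((0 : ℕ) : ℤ)) 0 rfl).hom, ← h, comp_zero]
    · rintro ⟨_, rfl⟩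
      exact ⟨0, comp_zero.symm⟩

open Abelian in
/-- The two constructions of `Ext` in Mathlib agree, naturally in the first variable. -/
lemma exists_ext_equiv_abelian_ext (n : ℕ) (Y : ModuleCat.{u} R) :
    ∃ e : ∀ X : ModuleCat.{u} R, ((_root_.Ext R (ModuleCat.{u} R) n).obj (Opposite.op X)).obj Y ≃
      Abelian.Ext X Y n, (∀ X, e X 0 = 0) ∧ ∀ (X X' : ModuleCat.{u} R) (f : X ⟶ X') x,
        e X ((((_root_.Ext R (ModuleCat.{u} R) n).map f.op).app Y).hom x) =
          (Ext.mk₀ f).comp (e X' x) (zero_add n) := by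
  have key : ∀ X : ModuleCat.{u} R,
      ∃ e : ((_root_.Ext R (ModuleCat.{u} R) n).obj (Opposite.op X)).obj Y ≃ Abelian.Ext X Y n,
        ∀ g : (projectiveResolution X).cocycles n Y,
          e ((projectiveResolution X).cocycleToExt n Y g) =
            (projectiveResolution X).extMk g.1 (n + 1) rfl
              (ProjectiveResolution.mem_cocycles.1 g.2) := fun X ↦ by
    let P := projectiveResolution X
    have hs := P.cocycleToExt_surjective n Y
    -- Both classes vanish exactly on coboundaries, so matching representatives is well defined and
    -- injective.
    have hiff : ∀ g g' : P.cocycles n Y, P.cocycleToExt n Y g = P.cocycleToExt n Y g' ↔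
        P.extMk g.1 (n + 1) rfl (ProjectiveResolution.mem_cocycles.1 g.2) =
          P.extMk g'.1 (n + 1) rfl (ProjectiveResolution.mem_cocycles.1 g'.2) := fun g g' ↦ by
      rw [← sub_eq_zero, ← sub_eq_zero (a := P.extMk g.1 (n + 1) rfl _), ← map_sub,
        P.sub_extMk, P.cocycleToExt_eq_zero_iff, P.extMk_eq_zero_iff_of_prev]
      rfl
    refine ⟨Equiv.ofBijective (fun x ↦ P.extMk (Function.surjInv hs x).1 (n + 1) rfl
      (ProjectiveResolution.mem_cocycles.1 (Function.surjInv hs x).2))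
        ⟨fun x y h ↦ ?_, fun z ↦ ?_⟩, fun g ↦ ?_⟩
    · rw [← hiff, Function.surjInv_eq hs, Function.surjInv_eq hs] at h
      exact h
    · obtain ⟨g, hg, rfl⟩ := P.extMk_surjective z (n + 1) rfl
      exact ⟨P.cocycleToExt n Y ⟨g, hg⟩, (hiff _ ⟨g, hg⟩).1 (Function.surjInv_eq _ _)⟩
    · exact (hiff _ g).1 (Function.surjInv_eq _ _)
  choose e he using key
  refine ⟨e, fun X ↦ ?_, fun X X' f x ↦ ?_⟩
  · have := he X 0
    rw [map_zero] at this
    rw [this]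
    exact (projectiveResolution X).extMk_zero (n + 1) rfl
  · obtain ⟨g, rfl⟩ := (projectiveResolution X').cocycleToExt_surjective n Y x
    let φ := ProjectiveResolution.liftHom f (projectiveResolution X) (projectiveResolution X')
    rw [he, ProjectiveResolution.map_cocycleToExt φ, he,
      ProjectiveResolution.mk₀_comp_extMk _ _ _ _ φ]

end CategoryTheory

/-! ### Injectivity and surjectivity of pullback on Ext -/

open CategoryTheory Limits Abelian

namespace CategoryTheory.Abelian.Ext
variable {R : Type u} [CommRing R] {M N : Type u} [AddCommGroup M] [Module R M]
  [AddCommGroup N] [Module R N] {Y : ModuleCat.{u} R}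

/-- The kernel of the pullback is the image of Ext^(n-1)(ker g, Y); for n = 0 the vanishing
hypothesis is vacuous and g is an epimorphism. -/
lemma precomp_injective_of_surjective {g : M →ₗ[R] N} (hg : Function.Surjective g) {n : ℕ}
    (h : ∀ j, j + 1 = n → Subsingleton (Ext (ModuleCat.of R (LinearMap.ker g)) Y j)) :
    ∀ x : Ext (ModuleCat.of R N) Y n,
      (Ext.mk₀ (ModuleCat.ofHom g)).comp x (zero_add n) = 0 → x = 0 := by
  intro x hx
  cases n with
  | zero =>
    have : Epi (ModuleCat.ofHom g) := (ModuleCat.epi_iff_surjective _).2 hg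
    exact precomp_mk₀_injective_of_epi Y (ModuleCat.ofHom g) (by simpa using hx)
  | succ n =>
    obtain ⟨y, rfl⟩ := contravariant_sequence_exact₃ (LinearMap.shortExact_shortComplexKer hg) Y x
      hx (add_comm 1 n)
    have := h n rfl
    rw [Subsingleton.elim y 0, comp_zero]

lemma shortExact_range {f : M →ₗ[R] N} (hf : Function.Injective f) :
    (ModuleCat.shortComplexOfCompEqZero f (LinearMap.range f).mkQ
      f.exact_map_mkQ_range.linearMap_comp_eq_zero).ShortExact :=
  ModuleCat.shortComplex_shortExact _ f.exact_map_mkQ_range hf (Submodule.mkQ_surjective _)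

lemma precomp_surjective_of_injective {f : M →ₗ[R] N} (hf : Function.Injective f) {n : ℕ}
    (h : Subsingleton (Ext (ModuleCat.of R (N ⧸ LinearMap.range f)) Y (n + 1)))
    (x : Ext (ModuleCat.of R M) Y n) :
    ∃ y : Ext (ModuleCat.of R N) Y n, (Ext.mk₀ (ModuleCat.ofHom f)).comp y (zero_add n) = x :=
  contravariant_sequence_exact₁ (shortExact_range hf) Y x (add_comm 1 n) (h.elim _ _)

end CategoryTheory.Abelian.Ext

/-! ### Homomorphisms into local cohomology -/

section
variable {R : Type u} [CommRing R] (I : Ideal R) (d : ℕ) (Y : ModuleCat.{u} R)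

/-- The map from `Ext^d(R/I^k, Y)` to the local cohomology module `H_I^d(Y)`. -/
noncomputable def localCohomology.ofExt (k : ℕ) :
    ((_root_.Ext R (ModuleCat.{u} R) d).obj (Opposite.op (ModuleCat.of R (R ⧸ I ^ k)))).obj Y →ₗ[R]
      (localCohomology I d).obj Y :=
  ((colimit.ι (localCohomology.diagram (localCohomology.idealPowersDiagram I) d)
    (Opposite.op (Opposite.op k))).app Y).hom

lemma localCohomology.ofExt_eq_zero (k : ℕ) (x) (hx : localCohomology.ofExt I d Y k x = 0) :
    ∃ (l : ℕ) (h : k ≤ l),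
      (((_root_.Ext R (ModuleCat.{u} R) d).map
        (ModuleCat.ofHom (Submodule.factor
          (Ideal.pow_le_pow_right (I := I) h))).op).app Y).hom x = 0 := by
  let D := localCohomology.diagram (localCohomology.idealPowersDiagram I) d
  let F := D ⋙ (evaluation _ _).obj Y
  have hc := isColimitOfPreserves ((evaluation _ _).obj Y) (colimit.isColimit D)
  -- The index category lives in universe 0, the modules in universe u. In a filtered colimit an
  -- element that becomes zero is already zero at a finite stage.
  have : PreservesFilteredColimitsOfSize.{0, 0} (forget (ModuleCat.{u} R)) :=
    preservesFilteredColimitsOfSize_shrink.{0, u, 0, u} _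
  obtain ⟨j, f, g, h⟩ := (Concrete.isColimit_rep_eq_iff_exists F hc
    (i := Opposite.op (Opposite.op k))
    (j := Opposite.op (Opposite.op k)) x 0).1 (hx.trans (map_zero _).symm)
  refine ⟨j.unop.unop, f.unop.unop.down.down, ?_⟩
  refine (h.trans (map_zero (F.map g).hom))

/-- Maps from a module killed by `I ^ k` to local cohomology given by a class in `Ext`. -/
lemma exists_hom_localCohomology [IsNoetherianRing R] {M : Type u} [AddCommGroup M] [Module R M]
    {k : ℕ} (hM : ∀ r ∈ I ^ k, ∀ y : M, r • y = 0) (x : M)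
    (h₁ : Subsingleton (Abelian.Ext (ModuleCat.of R (M ⧸ Submodule.span R {x})) Y (d + 1)))
    (h₂ : ∀ (J : Type u) [AddCommGroup J] [Module R J] [Module.Finite R J] (l : ℕ),
      (∀ r ∈ I ^ l, ∀ y : J, r • y = 0) → ∀ j < d,
        Subsingleton (Abelian.Ext (ModuleCat.of R J) Y j))
    (h₃ : Nontrivial (Abelian.Ext (ModuleCat.of R (Submodule.span R {x})) Y d)) :
    ∃ f : M →ₗ[R] (localCohomology I d).obj Y, f x ≠ 0 := by
  obtain ⟨e, he0, he⟩ := exists_ext_equiv_abelian_ext d Y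
  let φ : M →ₗ[R] ((R ⧸ I ^ k) →ₗ[R] M) :=
    { toFun y := (I ^ k).liftQ (LinearMap.toSpanSingleton R M y) fun r hr ↦ hM r hr y
      map_add' y z := Submodule.linearMap_qext _ (LinearMap.ext fun a ↦ smul_add a y z)
      map_smul' r y := Submodule.linearMap_qext _ (LinearMap.ext fun a ↦ smul_comm a r y) }
  obtain ⟨c, hc⟩ := exists_ne (0 : Abelian.Ext (ModuleCat.of R (Submodule.span R {x})) Y d)
  -- The obstruction to extending c from Rx to M lies in Ext^(d+1)(M/Rx, Y) = 0.
  obtain ⟨t', ht'⟩ := Ext.precomp_surjective_of_injective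
    (Submodule.span R {x}).injective_subtype (by rwa [Submodule.range_subtype]) c
  obtain ⟨t, rfl⟩ := (e _).surjective t'
  refine ⟨localCohomology.ofExt I d Y k ∘ₗ
    { toFun y := (((_root_.Ext R (ModuleCat.{u} R) d).map
        (ModuleCat.ofHom (φ y)).op).app Y).hom t
      map_add' y z := ?_
      map_smul' r y := ?_ }, fun h ↦ hc ?_⟩
  · have := ext_map_smul_add d Y 1 (ModuleCat.ofHom (φ y)) (ModuleCat.ofHom (φ z)) t
    rw [one_smul, one_smul, ← ModuleCat.ofHom_add, ← map_add] at this
    exact this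
  · have h0 := ext_map_smul_add d Y 1 (ModuleCat.ofHom (φ 0)) (ModuleCat.ofHom (φ 0)) t
    rw [one_smul, one_smul, ← ModuleCat.ofHom_add, ← map_add, add_zero, left_eq_add] at h0
    have := ext_map_smul_add d Y r (ModuleCat.ofHom (φ y)) (ModuleCat.ofHom (φ 0)) t
    rw [h0, add_zero, map_zero φ] at this
    rw [RingHom.id_apply, ← this, map_smul]
    congr 6
    ext
    simp
  obtain ⟨l, hl, h⟩ := localCohomology.ofExt_eq_zero I d Y k _ h
  set p := Submodule.factor (Ideal.pow_le_pow_right (I := I) hl)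
  -- The map 1 ↦ x with target cut down to Rx: vanishing at stage l says that c pulls back to zero
  -- along q, while this pullback is injective by `h₂`.
  let q : (R ⧸ I ^ l) →ₗ[R] Submodule.span R {x} :=
    LinearMap.codRestrict _ (φ x ∘ₗ p) fun a ↦ by
      obtain ⟨a, rfl⟩ := Submodule.Quotient.mk_surjective _ a
      exact Submodule.mem_span_singleton.2 ⟨a, rfl⟩
  have hq : Function.Surjective q := by
    rintro ⟨y, hy⟩
    obtain ⟨a, rfl⟩ := Submodule.mem_span_singleton.1 hy
    exact ⟨Submodule.Quotient.mk a, rfl⟩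
  refine Ext.precomp_injective_of_surjective hq (fun j hj ↦ h₂ _ l ?_ j (by omega)) c ?_
  · rintro r hr ⟨y, -⟩
    apply Subtype.ext
    obtain ⟨a, rfl⟩ := Submodule.Quotient.mk_surjective _ y
    exact (Submodule.Quotient.mk_eq_zero _).2 ((I ^ l).mul_mem_right a hr)
  · rw [← ht', Ext.mk₀_comp_mk₀_assoc]
    have h5 := congrArg (e _) h
    rw [he0] at h5
    erw [he, he, Ext.mk₀_comp_mk₀_assoc] at h5
    exact h5
end

/-! ### Regular sequences of maximal length and Ext -/

section
open RingTheory.Sequence IsLocalRing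

lemma IsLocalRing.maximalIdeal_smul_top_lt_top {R : Type u} [CommRing R] [IsLocalRing R]
    {M : Type u} [AddCommGroup M] [Module R M]
    [Module.Finite R M] [Nontrivial M] : maximalIdeal R • (⊤ : Submodule R M) < ⊤ :=
  (Submodule.top_ne_ideal_smul_of_le_jacobson_annihilator
    (maximalIdeal_le_jacobson (Module.annihilator R M))).symm.lt_top

variable {R : Type u} [CommRing R] [IsLocalRing R] [IsNoetherianRing R]

/-- The length of a regular sequence is bounded by the Krull dimension, so a longest one exists. -/
lemma exists_maximal_isRegular (R : Type u) [CommRing R] [IsLocalRing R] [IsNoetherianRing R] :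
    ∃ rs : List R, IsRegular R rs ∧ (∀ r ∈ rs, r ∈ maximalIdeal R) ∧
      ∀ rs' : List R, (∀ r ∈ rs', r ∈ maximalIdeal R) → IsRegular R rs' →
        rs'.length ≤ rs.length := by
  classical
  let P : ℕ → Prop := fun t ↦
    ∃ rs : List R, rs.length = t ∧ IsRegular R rs ∧ ∀ r ∈ rs, r ∈ maximalIdeal R
  have hb : ∀ t, P t → t ≤ localKrullDim R := by
    rintro t ⟨rs, rfl, hrs, -⟩
    have h1 := ringKrullDim_add_length_eq_ringKrullDim_of_isRegular rs hrs
    have : Nontrivial (R ⧸ Ideal.ofList rs) := by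
      refine Ideal.Quotient.nontrivial_iff.2 fun h ↦ hrs.2 ?_
      rw [h, Submodule.top_smul]
    have h2 : (0 : WithBot ℕ∞) ≤ ringKrullDim (R ⧸ Ideal.ofList rs) :=
      ringKrullDim_nonneg_of_nontrivial
    have h3 : (rs.length : WithBot ℕ∞) ≤ ringKrullDim R := by
      rw [← h1]
      exact le_add_of_nonneg_left h2
    rw [← coe_localKrullDim R] at h3
    exact_mod_cast h3
  have h0 : P 0 := ⟨[], rfl, IsRegular.nil R R, by simp⟩
  obtain ⟨rs, hl, hrs, hm⟩ := Nat.findGreatest_spec (P := P) (Nat.zero_le (localKrullDim R)) h0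
  refine ⟨rs, hrs, hm, fun rs' hm' hrs' ↦ ?_⟩
  rw [hl]
  exact Nat.le_findGreatest (hb _ ⟨rs', rfl, hrs', hm'⟩) ⟨rs', rfl, hrs', hm'⟩

/-- Vanishing of `Ext^j(N, R)` below the depth, for `N` supported at the maximal ideal. -/
lemma subsingleton_ext_of_pow_smul_eq_zero {rs : List R} (hrs : IsRegular R rs)
    (hm : ∀ r ∈ rs, r ∈ maximalIdeal R)
    {N : Type u} [AddCommGroup N] [Module R N]
    [Module.Finite R N] (l : ℕ) (hN : ∀ r ∈ maximalIdeal R ^ l, ∀ y : N, r • y = 0) {j : ℕ}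
    (hj : j < rs.length) :
    Subsingleton (Ext (ModuleCat.of R N) (ModuleCat.of R R) j) := by
  refine ModuleCat.subsingleton_ext_of_exists_isRegular (maximalIdeal R) (ModuleCat.of R N) ?_
    (ModuleCat.of R R) maximalIdeal_smul_top_lt_top rs hm hrs j hj
  have : maximalIdeal R ^ l ≤ Module.annihilator R N := fun r hr ↦
    Module.mem_annihilator.2 (hN r hr)
  rw [Module.support_eq_zeroLocus, PrimeSpectrum.zeroLocus_subset_zeroLocus_iff]
  exact fun r hr ↦ ⟨l, this (Ideal.pow_mem_pow hr l)⟩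

/-- Otherwise Ext^i(R/m, R) would vanish for all i up to the length, and Rees' criterion would give
a regular sequence one longer. -/
lemma nontrivial_ext_residueField {rs : List R} (hrs : IsRegular R rs)
    (hm : ∀ r ∈ rs, r ∈ maximalIdeal R)
    (hmax : ∀ rs' : List R, (∀ r ∈ rs', r ∈ maximalIdeal R) → IsRegular R rs' →
      rs'.length ≤ rs.length) :
    Nontrivial (Ext (ModuleCat.of R (R ⧸ maximalIdeal R)) (ModuleCat.of R R) rs.length) := by
  by_contra hcon
  rw [not_nontrivial_iff_subsingleton] at hcon
  obtain ⟨rs', hl, hm', hrs'⟩ := ModuleCat.exists_isRegular_of_exists_subsingleton_ext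
    (maximalIdeal R) (rs.length + 1) (ModuleCat.of R R) maximalIdeal_smul_top_lt_top
    (ModuleCat.of R (R ⧸ maximalIdeal R)) (by
      rw [Module.support_eq_zeroLocus, Ideal.annihilator_quotient]) fun i hi ↦ by
        rcases Nat.lt_succ_iff_lt_or_eq.1 hi with h | rfl
        · exact subsingleton_ext_of_pow_smul_eq_zero hrs hm 1 (fun r hr y ↦ by
            obtain ⟨y, rfl⟩ := Ideal.Quotient.mk_surjective y
            rw [pow_one] at hr
            exact Ideal.Quotient.eq_zero_iff_mem.2 (Ideal.mul_mem_right _ _ hr)) h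
        · exact hcon
  have := hmax rs' hm' hrs'
  omega

/-- Otherwise Hom(R/m, R/(rs)) = 0, since R/m is simple; then m contains a regular element on
R/(rs), and appending it lengthens rs. -/
lemma exists_injective_residueField {rs : List R} (hrs : IsRegular R rs)
    (hm : ∀ r ∈ rs, r ∈ maximalIdeal R)
    (hmax : ∀ rs' : List R, (∀ r ∈ rs', r ∈ maximalIdeal R) → IsRegular R rs' →
      rs'.length ≤ rs.length) :
    ∃ f : (R ⧸ maximalIdeal R) →ₗ[R] (R ⧸ Ideal.ofList rs), Function.Injective f := by
  by_contra! hcon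
  have : Nontrivial (R ⧸ Ideal.ofList rs) := by
    refine Ideal.Quotient.nontrivial_iff.2 fun h ↦ hrs.2 ?_
    rw [h, Submodule.top_smul]
  obtain ⟨rs', hl, hm', hrs'⟩ := ModuleCat.exists_isRegular_of_exists_subsingleton_ext
    (maximalIdeal R) 1 (ModuleCat.of R (R ⧸ Ideal.ofList rs)) maximalIdeal_smul_top_lt_top
    (ModuleCat.of R (R ⧸ maximalIdeal R)) (by
      rw [Module.support_eq_zeroLocus, Ideal.annihilator_quotient]) fun i hi ↦ by
        obtain rfl : i = 0 := by omega
        refine (Ext.addEquiv₀.trans ModuleCat.homAddEquiv).toEquiv.subsingleton_congr.2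
          (subsingleton_of_forall_eq 0 fun f ↦ ?_)
        by_contra hf
        have : IsSimpleModule R (R ⧸ maximalIdeal R) :=
          isSimpleModule_iff_isCoatom.2 (maximalIdeal.isMaximal R).out
        exact hcon f ((LinearMap.injective_or_eq_zero f).resolve_right hf)
  have hw : IsWeaklyRegular R (rs ++ rs') := (isWeaklyRegular_append_iff R rs rs').2
    ⟨hrs.1, by
      have e : (R ⧸ Ideal.ofList rs) ≃ₗ[R] (R ⧸ (Ideal.ofList rs • ⊤ : Submodule R R)) :=
        Submodule.quotEquivOfEq _ _ (by simp)
      exact (e.isWeaklyRegular_congr rs').1 hrs'.1⟩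
  have hm2 : ∀ r ∈ rs ++ rs', r ∈ maximalIdeal R := fun r hr ↦
    (List.mem_append.1 hr).elim (hm r) (hm' r)
  have := hmax _ hm2 (IsRegular.of_isWeaklyRegular_of_mem_maximalIdeal R hm2 hw)
  rw [List.length_append, hl] at this
  omega

end

/-! ### Finite injective dimension, depth equal to dimension, and cogeneration by H -/

section
open RingTheory.Sequence IsLocalRing
variable {R : Type u} [CommRing R] [IsLocalRing R] [IsNoetherianRing R]

lemma subsingleton_ext_quotient_ofList {rs : List R} (hrs : IsRegular R rs) {j : ℕ}
    (hj : rs.length < j) (Y : ModuleCat.{u} R) :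
    Subsingleton (Ext (ModuleCat.of R (R ⧸ Ideal.ofList rs)) Y j) := by
  have h := ModuleCat.projectiveDimension_quotient_eq_length rs hrs
  rw [projectiveDimension_eq_of_iso (Shrink.linearEquiv R (R ⧸ Ideal.ofList rs)).toModuleIso] at h
  have := (projectiveDimension_le_iff _ _).1 h.le
  exact HasProjectiveDimensionLT.subsingleton _ (rs.length + 1) j hj Y

/-- Vanishing of Ext^(n+1)(N/aN, Y) makes multiplication by a surjective on the finitely generated
module Ext^n(N, Y); Nakayama then applies. -/
lemma subsingleton_ext_of_isSMulRegular {N : Type u} [AddCommGroup N] [Module R N]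
    [Module.Finite R N] {a : R} (ha : a ∈ maximalIdeal R) (hN : IsSMulRegular N a)
    {Y : ModuleCat.{u} R} [Module.Finite R Y] {n : ℕ}
    (h : Subsingleton
      (Ext (ModuleCat.of R (N ⧸ LinearMap.range (LinearMap.lsmul R N a))) Y (n + 1))) :
    Subsingleton (Ext (ModuleCat.of R N) Y n) := by
  by_contra hcon
  rw [not_subsingleton_iff_nontrivial] at hcon
  refine Submodule.top_ne_pointwise_smul_of_mem_jacobson_annihilator
    (R := R) (M := Ext (ModuleCat.of R N) Y n) (maximalIdeal_le_jacobson _ ha)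
    (top_le_iff.1 fun x _ ↦ ?_).symm
  obtain ⟨y, rfl⟩ := Ext.precomp_surjective_of_injective (f := LinearMap.lsmul R N a) hN h x
  refine ⟨y, trivial, ?_⟩
  have : ModuleCat.ofHom (LinearMap.lsmul R N a) = a • 𝟙 (ModuleCat.of R N) := rfl
  rw [this, Ext.mk₀_smul, Ext.smul_comp, Ext.mk₀_id_comp]
  rfl

lemma Ideal.isSMulRegular_quotient_of_notMem {R : Type u} [CommRing R] {p : Ideal R} [p.IsPrime]
    {a : R} (ha : a ∉ p) : IsSMulRegular (R ⧸ p) a := by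
  refine isSMulRegular_iff_right_eq_zero_of_smul.2 fun x hx ↦ ?_
  obtain ⟨x, rfl⟩ := Ideal.Quotient.mk_surjective x
  exact Ideal.Quotient.eq_zero_iff_mem.2 <|
    (‹p.IsPrime›.mem_or_mem (Ideal.Quotient.eq_zero_iff_mem.1 hx)).resolve_left ha

/-- If `Y` has finite injective dimension then `Ext^j(-, Y)` vanishes on finitely generated modules
for all `j` above the length of a maximal regular sequence. -/
lemma subsingleton_ext_of_length_lt {rs : List R} (hrs : IsRegular R rs)
    {f : (R ⧸ maximalIdeal R) →ₗ[R] (R ⧸ Ideal.ofList rs)} (hf : Function.Injective f)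
    (Y : ModuleCat.{u} R) [Module.Finite R Y] {n : ℕ} [HasInjectiveDimensionLT Y n] {j : ℕ}
    (hj : rs.length < j) (M : Type u) [AddCommGroup M] [Module R M] [Module.Finite R M] :
    Subsingleton (Ext (ModuleCat.of R M) Y j) := by
  by_cases hn : n ≤ j
  · exact HasInjectiveDimensionLT.subsingleton _ n j hn _
  -- Descending induction on j, starting from the bound n on the injective dimension.
  have ih (N : Type u) [AddCommGroup N] [Module R N] [Module.Finite R N] :
      Subsingleton (Ext (ModuleCat.of R N) Y (j + 1)) :=
    subsingleton_ext_of_length_lt hrs hf Y (n := n) (by omega) N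
  -- Ext^j(R/(rs), Y) maps onto Ext^j(R/m, Y), the obstruction being in degree j + 1, and it is zero
  -- because R/(rs) has projective dimension below j.
  have hk : Subsingleton (Ext (ModuleCat.of R (R ⧸ maximalIdeal R)) Y j) :=
    subsingleton_of_forall_eq 0 fun x ↦ by
      obtain ⟨y, rfl⟩ := Ext.precomp_surjective_of_injective hf (ih _) x
      rw [(subsingleton_ext_quotient_ofList hrs hj Y).elim y 0, Ext.comp_zero]
  induction ‹Module.Finite R M› using
    IsNoetherianRing.induction_on_isQuotientEquivQuotientPrime R with
  | subsingleton N =>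
    have : IsZero (ModuleCat.of R N) := ModuleCat.isZero_of_subsingleton _
    exact subsingleton_of_forall_eq 0 fun x ↦ by
      rw [← Ext.mk₀_id_comp x, this.eq_of_src (𝟙 _) 0, Ext.mk₀_zero, Ext.zero_comp]
  | quotient N p e =>
    have hp := p.2
    have : Subsingleton (Ext (ModuleCat.of R (R ⧸ p.1)) Y j) := by
      by_cases hpm : p.1 = maximalIdeal R
      · rw [hpm]
        exact hk
      · obtain ⟨a, ha, hap⟩ := SetLike.exists_of_lt ((le_maximalIdeal hp.ne_top).lt_of_ne hpm)
        exact subsingleton_ext_of_isSMulRegular ha (Ideal.isSMulRegular_quotient_of_notMem hap)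
          (ih _)
    refine subsingleton_of_forall_eq 0 fun x ↦ ?_
    have : (Ext.mk₀ e.toModuleIso.hom).comp ((Ext.mk₀ e.toModuleIso.inv).comp x (zero_add j))
        (zero_add j) = 0 := by
      rw [this.elim ((Ext.mk₀ e.toModuleIso.inv).comp x (zero_add j)) 0, Ext.comp_zero]
    rwa [Ext.mk₀_comp_mk₀_assoc, Iso.hom_inv_id, Ext.mk₀_id_comp] at this
  | exact N₁ N₂ N₃ f g hf hg hfg h₁ h₃ =>
    have hS := ModuleCat.shortComplex_shortExact
      (ModuleCat.shortComplexOfCompEqZero f g hfg.linearMap_comp_eq_zero) hfg hf hg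
    refine subsingleton_of_forall_eq 0 fun x ↦ ?_
    obtain ⟨y, rfl⟩ := Ext.contravariant_sequence_exact₂ hS Y x (h₁.elim _ _)
    exact (congrArg (fun z ↦ Ext.comp _ z _) (h₃.elim y 0)).trans (Ext.comp_zero _ _ _ _ _)
termination_by n - j

/-- If `Ext^t(R/m, R)` is nontrivial, where `t` is the length of a regular sequence in `I`, then so
is `Ext^t(N, R)` for every finitely generated `N` killed by a power of `I` that surjects onto the
residue field. -/
lemma nontrivial_ext_of_surjective {I : Ideal R} {rs : List R} (hrs : IsRegular R rs)
    (hI : ∀ r ∈ rs, r ∈ I) (hIm : I ≤ maximalIdeal R)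
    (hk : Nontrivial (Ext (ModuleCat.of R (R ⧸ maximalIdeal R)) (ModuleCat.of R R) rs.length))
    {N : Type u} [AddCommGroup N] [Module R N] [Module.Finite R N] {l : ℕ}
    (hN : ∀ r ∈ I ^ l, ∀ y : N, r • y = 0) {g : N →ₗ[R] (R ⧸ maximalIdeal R)}
    (hg : Function.Surjective g) :
    Nontrivial (Ext (ModuleCat.of R N) (ModuleCat.of R R) rs.length) := by
  by_contra hcon
  rw [not_nontrivial_iff_subsingleton] at hcon
  -- The kernel of g is killed by I^l, so its Ext vanishes below the length of rs; hence Ext^t(R/m,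
  -- R) embeds in Ext^t(N, R).
  refine not_subsingleton_iff_nontrivial.2 hk (subsingleton_of_forall_eq 0 fun x ↦
    Ext.precomp_injective_of_surjective hg (fun j hj ↦ ?_) x (hcon.elim _ _))
  refine ModuleCat.subsingleton_ext_of_exists_isRegular I (ModuleCat.of R (LinearMap.ker g)) ?_
    (ModuleCat.of R R) ((Submodule.smul_mono_left hIm).trans_lt maximalIdeal_smul_top_lt_top) rs hI
    hrs j (by omega)
  have : I ^ l ≤ Module.annihilator R (LinearMap.ker g) := fun r hr ↦
    Module.mem_annihilator.2 fun y ↦ Subtype.ext (hN r hr y)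
  rw [Module.support_eq_zeroLocus, PrimeSpectrum.zeroLocus_subset_zeroLocus_iff]
  exact fun r hr ↦ ⟨l, this (Ideal.pow_mem_pow hr l)⟩

/-- A regular sequence of length `t` has length the dimension if `Ext^t(R/m, R)` is nontrivial and
`Ext^(t+1)(-, R)` vanishes on finitely generated modules. -/
lemma length_eq_localKrullDim {rs : List R} (hrs : IsRegular R rs)
    (hm : ∀ r ∈ rs, r ∈ maximalIdeal R)
    (hk : Nontrivial (Ext (ModuleCat.of R (R ⧸ maximalIdeal R)) (ModuleCat.of R R) rs.length))
    (hv : ∀ (M : Type u) [AddCommGroup M] [Module R M] [Module.Finite R M],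
      Subsingleton (Ext (ModuleCat.of R M) (ModuleCat.of R R) (rs.length + 1))) :
    rs.length = localKrullDim R := by
  have hI : Ideal.ofList rs ≤ maximalIdeal R := Ideal.span_le.2 hm
  have hprime (p : Ideal R) [p.IsPrime] (hp : Ideal.ofList rs ≤ p) : p = maximalIdeal R := by
    by_contra hpm
    have hle := le_maximalIdeal (Ideal.IsPrime.ne_top ‹p.IsPrime›)
    obtain ⟨a, ha, hap⟩ := SetLike.exists_of_lt (hle.lt_of_ne hpm)
    have h1 : Subsingleton (Ext (ModuleCat.of R (R ⧸ p)) (ModuleCat.of R R) rs.length) :=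
      subsingleton_ext_of_isSMulRegular ha (Ideal.isSMulRegular_quotient_of_notMem hap) (hv _)
    -- The ideal is (rs) rather than m: R/p is killed by (rs), but by no power of m when p ≠ m.
    refine not_subsingleton_iff_nontrivial.2 (nontrivial_ext_of_surjective (I := Ideal.ofList rs)
      (N := R ⧸ p) (l := 1) (g := Submodule.factor hle) hrs
      (fun r hr ↦ Ideal.subset_span hr) hI hk (fun r hr y ↦ ?_)
      (Submodule.factor_surjective hle)) h1
    obtain ⟨y, rfl⟩ := Ideal.Quotient.mk_surjective y
    rw [pow_one] at hr
    exact Ideal.Quotient.eq_zero_iff_mem.2 (Ideal.mul_mem_right _ _ (hp hr))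
  have hnt : Nontrivial (R ⧸ Ideal.ofList rs) :=
    Ideal.Quotient.nontrivial_iff.2 fun h ↦ (maximalIdeal.isMaximal R).ne_top (top_le_iff.1 (h ▸ hI))
  have hdim : ringKrullDim (R ⧸ Ideal.ofList rs) = 0 := by
    refine le_antisymm ?_ ringKrullDim_nonneg_of_nontrivial
    have : Ring.KrullDimLE 0 (R ⧸ Ideal.ofList rs) := Ring.krullDimLE_zero_iff.2 fun q hq ↦ by
      have h1 := hprime (q.comap (Ideal.Quotient.mk (Ideal.ofList rs))) fun r hr ↦ by
        rw [Ideal.mem_comap, Ideal.Quotient.eq_zero_iff_mem.2 hr]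
        exact q.zero_mem
      have : (q.comap (Ideal.Quotient.mk (Ideal.ofList rs))).IsMaximal := by
        rw [h1]
        infer_instance
      rw [← Ideal.map_comap_of_surjective _ Ideal.Quotient.mk_surjective q]
      exact (Ideal.map_eq_top_or_isMaximal_of_surjective _ Ideal.Quotient.mk_surjective
        this).resolve_left (by
          rw [Ideal.map_comap_of_surjective _ Ideal.Quotient.mk_surjective q]
          exact hq.ne_top)
    exact Order.krullDimLE_iff _ _ |>.1 this
  have h := ringKrullDim_add_length_eq_ringKrullDim_of_isRegular rs hrs
  rw [hdim, zero_add, ← coe_localKrullDim R] at h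
  exact_mod_cast h

/-- Over a Gorenstein local ring the top local cohomology cogenerates the finitely generated
modules. -/
theorem IsGorensteinLocalRing.exists_hom_topLocalCohomology_ne_zero (hR : IsGorensteinLocalRing R)
    {M : Type u} [AddCommGroup M] [Module R M] [Module.Finite R M] {x : M} (hx : x ≠ 0) :
    ∃ f : M →ₗ[R] topLocalCohomology R, f x ≠ 0 := by
  obtain ⟨n, hn⟩ := hR
  obtain ⟨rs, hrs, hm, hmax⟩ := exists_maximal_isRegular R
  obtain ⟨i, hi⟩ := exists_injective_residueField hrs hm hmax
  have hk := nontrivial_ext_residueField hrs hm hmax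
  have hv (N : Type u) [AddCommGroup N] [Module R N] [Module.Finite R N] :
      Subsingleton (Ext (ModuleCat.of R N) (ModuleCat.of R R) (rs.length + 1)) :=
    subsingleton_ext_of_length_lt hrs hi (ModuleCat.of R R) (n := n + 1) (Nat.lt_succ_self _) N
  have hd := length_eq_localKrullDim hrs hm hk hv
  obtain ⟨k, hkx⟩ : ∃ k : ℕ, x ∉ (maximalIdeal R ^ k • ⊤ : Submodule R M) := by
    by_contra! h
    refine hx ?_
    have := Ideal.iInf_pow_smul_eq_bot_of_isLocalRing (M := M) (maximalIdeal R)
      (maximalIdeal.isMaximal R).ne_top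
    exact (Submodule.mem_bot R).1 (this ▸ (Submodule.mem_iInf _).2 h)
  let Q := M ⧸ (maximalIdeal R ^ k • ⊤ : Submodule R M)
  let y : Q := Submodule.Quotient.mk x
  have hy : y ≠ 0 := fun h ↦ hkx ((Submodule.Quotient.mk_eq_zero _).1 h)
  have hQ : ∀ r ∈ maximalIdeal R ^ k, ∀ z : Q, r • z = 0 := fun r hr z ↦ by
    obtain ⟨z, rfl⟩ := Submodule.mkQ_surjective _ z
    rw [← map_smul]
    exact (Submodule.Quotient.mk_eq_zero _).2 (Submodule.smul_mem_smul hr trivial)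
  -- Since y ≠ 0, Ry ≅ R/Ann(y) surjects onto the residue field, which gives Ext^d(Ry, R) ≠ 0.
  have hle : Ideal.torsionOf R Q y ≤ maximalIdeal R := le_maximalIdeal fun h ↦
    hy ((Ideal.torsionOf_eq_top_iff R y).1 h)
  have h₃ : Nontrivial (Ext (ModuleCat.of R (Submodule.span R {y})) (ModuleCat.of R R)
      (localKrullDim R)) := by
    rw [← hd]
    refine nontrivial_ext_of_surjective (l := k) hrs hm le_rfl hk
      (fun r hr z ↦ Subtype.ext (hQ r hr z))
      (g := Submodule.factor hle ∘ₗ (Ideal.quotTorsionOfEquivSpanSingleton R Q y).symm.toLinearMap)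
      ((Submodule.factor_surjective hle).comp
        (Ideal.quotTorsionOfEquivSpanSingleton R Q y).symm.surjective)
  obtain ⟨f, hf⟩ := exists_hom_localCohomology (maximalIdeal R) (localKrullDim R)
    (ModuleCat.of R R) hQ y (hd ▸ hv _)
    (fun J _ _ _ l hJ j hj ↦ subsingleton_ext_of_pow_smul_eq_zero hrs hm l hJ (hd ▸ hj)) h₃
  exact ⟨f ∘ₗ Submodule.mkQ _, hf⟩

end

/-! ### Closures of zero and the equivalence -/

lemma ModuleClosure.closure_bot_eq_bot_of_hom {R : Type u} [CommRing R] {cl : ModuleClosure R}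
    (hfun : cl.IsFunctorial) {M H : Type u} [AddCommGroup M] [Module R M] [AddCommGroup H]
    [Module R H] (hH : cl.closure H ⊥ = ⊥)
    (hM : ∀ x : M, x ≠ 0 → ∃ f : M →ₗ[R] H, f x ≠ 0) : cl.closure M ⊥ = ⊥ := by
  refine (Submodule.eq_bot_iff _).2 fun x hx ↦ ?_
  by_contra h
  obtain ⟨f, hf⟩ := hM x h
  have := hfun M H f ⊥ (Submodule.mem_map_of_mem hx)
  rw [Submodule.map_bot, hH] at this
  exact hf this

theorem mainTheorem9 (R : Type u) [CommRing R] [IsLocalRing R] [IsNoetherianRing R]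
    [IsAdicComplete (IsLocalRing.maximalIdeal R) R] (hR : IsGorensteinLocalRing R)
    (E : Type u) [AddCommGroup E] [Module R E]
    (hE : IsInjectiveHull R (IsLocalRing.ResidueField R) E)
    (ω : Type u) [AddCommGroup ω] [Module R ω] (c : CanonicalModuleStructure R E ω)
    (cl : ModuleClosure R) (hres : cl.IsResidual) (hfun : cl.IsFunctorial)
    (hfin : cl.InjectiveFiniteness) :
    cl.IsWeaklyRegular ↔ cl.IsRational c := by
  constructor
  · intro h
    have h0 : cl.closure (topLocalCohomology R) ⊥ = ⊥ := by
      refine (Submodule.eq_bot_iff _).2 fun x hx ↦ ?_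
      have hx' : x ∈ cl.finitisticClosure (topLocalCohomology R) ⊥ := hfin ▸ hx
      obtain ⟨N, -, hN, y, hy, rfl⟩ := hx'
      have hb : (⊥ : Submodule R (topLocalCohomology R)).submoduleOf N = ⊥ :=
        LinearMap.ker_eq_bot.2 N.subtype_injective
      rw [hb] at hN hy
      have : Module.Finite R N := Module.Finite.equiv (Submodule.quotEquivOfEqBot _ rfl)
      rw [SetLike.mem_coe, h N this, Submodule.mem_bot] at hy
      rw [hy, map_zero]
    refine top_le_iff.1 fun w _ f hf ↦ ?_
    rw [h0, Submodule.map_bot, Submodule.mem_bot] at hf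
    rw [hf, LinearMap.zero_apply]
  · intro h
    have h0 : cl.closure (topLocalCohomology R) ⊥ = ⊥ := by
      -- An element of 0_H^cl, read as a functional on ω, vanishes on τ_cl(ω) = ω.
      refine (Submodule.eq_bot_iff _).2 fun x hx ↦ c.dualEquiv.map_eq_zero_iff.1 ?_
      ext w
      have hw : w ∈ cl.testSubmodule c := h ▸ Submodule.mem_top
      exact hw _ (Submodule.mem_map_of_mem hx)
    intro M _ _ _ N
    rw [hres M N N le_rfl, Submodule.mkQ_map_self,
      ModuleClosure.closure_bot_eq_bot_of_hom hfun h0 fun x hx ↦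
        hR.exists_hom_topLocalCohomology_ne_zero hx]
    exact N.ker_mkQ
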